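/- **Setting.** Let $(Con, Con_0,\sqsubseteq,\sqcup,true,false)$ be a complete algebraic lattice of constraints ($Con_0$ its finite, i.e. compact, elements), equipped with a cylindric structure over an infinite set $V$ of variables: continuous operators $\exists_x$ preserving $Con_0$, with $\exists_x c\sqsubseteq c$, $\exists_x$ monotone, $\exists_x(c\sqcup\exists_x d)=\exists_x c\sqcup\exists_x d$, $\exists_x\exists_y c=\exists_y\exists_x c$, and diagonal elements $d_{xy}\in Con_0$ with $d_{xx}=true$, $d_{xy}=\exists_z(d_{xz}\sqcup d_{zy})$ for $z\ne x,y$, and $c\sqsubseteq d_{xy}\sqcup\exists_x(c\sqcup d_{xy})$ for $x\neq y$. Put $fv(c)=\{x\mid \exists_x c\ne c\}$ and, for $x\neq z$, $c[z/x]=\exists_x(d_{xz}\sqcup c)$. Assume that $(Con,\sqsubseteq)$ is well-founded, or, alternatively, only that $(Con_0,\sqsubseteq)$ is well-founded and that neither the processes of $IS$ (below) nor the bodies of the procedure definitions contain the hiding operator. Processes are given by $P,Q ::= \mathbf 0 \mid \mathbf{tell}(c)\mid \mathbf{ask}(c)\to P\mid P\parallel Q\mid P+Q\mid \exists^{c}_{x}P\mid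 p(\vec z)$, with $c\in Con_0$ and a unique, possibly recursive, definition $p(\vec x)\stackrel{\rm def}{=}P$ with $fv(P)\subseteq\vec x$, $\vec x$ distinct, for every procedure identifier $p$. Substitution is capture-avoiding. A configuration $\langle P,d\rangle$ is a process with a store $d\in Con$. *Reductions* $\longrightarrow$ are generated by: $\langle\mathbf{tell}(c),d\rangle\to\langle\mathbf 0,d\sqcup c\rangle$; $\langle\mathbf{ask}(c)\to P,d\rangle\to\langle P,d\rangle$ if $c\sqsubseteq d$; if $\langle P,d\rangle\to\langle P',d'\rangle$, then $\langle P\parallel Q,d\rangle\to\langle P'\parallel Q,d'\rangle$ and $\langle P+Q,d\rangle\to\langle P',d'\rangle$, and symmetrically; if $\langle P,e\sqcup\exists_xd\rangle\to\langle P',e'\sqcup\exists_xd\rangle$, then $\langle\exists^e_xP,d\rangle\to\langle\exists^{e'}_xP',d\sqcup\exists_xe'\rangle$; if $\langle P[\vec z/\vec x],d\rangle\to\gamma'$ and $p(\vec x)\stackrel{\rm def}{=}P$, then $\langle p(\vec z),d\rangle\to\gamma'$. *Labelled transitions* $\stackrel{\alpha}{\longrightarrow}$, $\alpha\in Con_0$,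 are generated by: $\langle\mathbf{tell}(c),d\rangle\stackrel{true}{\to}\langle\mathbf 0,d\sqcup c\rangle$; $\langle\mathbf{ask}(c)\to P,d\rangle\stackrel{\alpha}{\to}\langle P,d\sqcup\alpha\rangle$ for every minimal element $\alpha$ of $\{a\in Con_0\mid c\sqsubseteq d\sqcup a\}$; the same rules as above, with labels, for $\parallel$, $+$ and $p(\vec z)$; and, if $\langle P[z/x],e[z/x]\sqcup d\rangle\stackrel{\alpha}{\to}\langle P',e'\sqcup d\sqcup\alpha\rangle$ with $x\notin fv(e')$ and $z\notin fv(P)\cup fv(e\sqcup d\sqcup\alpha)$, then $\langle\exists^e_xP,d\rangle\stackrel{\alpha}{\to}\langle\exists^{e'[x/z]}_xP'[x/z],\ \exists_x(e'[x/z])\sqcup d\sqcup\alpha\rangle$. *Saturated barbed bisimilarity* $\dot\sim_{sb}$ is the union of all symmetric relations $\mathcal R$ on configurations such that, whenever $(\langle P,d\rangle,\langle Q,e\rangle)\in\mathcal R$: every $c\in Con_0$ with $c\sqsubseteq d$ satisfies $c\sqsubseteq e$; if $\langle P,d\rangle\to\gamma_1'$, then $\langle Q,e\rangle\to\gamma_2'$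 for some $\gamma_2'$ with $(\gamma_1',\gamma_2')\in\mathcal R$; and $(\langle P,d\sqcup a\rangle,\langle Q,e\sqcup a\rangle)\in\mathcal R$ for all $a\in Con_0$. A transition $\gamma\stackrel{\alpha}{\to}\langle P_1,c'\rangle$ *derives* $\gamma\stackrel{\beta}{\to}\langle P_1,c''\rangle$ (written $\vdash_D$; the latter need not be generated by the rules) if $\alpha\ne\beta$ and, for some $e\in Con$, $\beta=\alpha\sqcup e$ and $c''=c'\sqcup e$. For a relation $\mathcal R$, a transition $\gamma\stackrel{\beta}{\to}\gamma_2$ is *redundant in $\mathcal R$* if some transition $\gamma\stackrel{\alpha}{\to}\gamma_1$ derives $\gamma\stackrel{\beta}{\to}\gamma_2'$ for some $\gamma_2'$ with $(\gamma_2',\gamma_2)\in\mathcal R$; otherwise it is *irredundant in $\mathcal R$*. Let $IS$ be a set of configurations. $IS^\star$ is the least set such that: (is) $IS\subseteq IS^\star$; (rs) $\gamma_1\in IS^\star$ and $\gamma_1\stackrel{\alpha}{\to}\gamma_2$ imply $\gamma_2\in IS^\star$; (rd) if $\gamma\in IS^\star$, $\gamma\stackrel{\alpha_1}{\to}\gamma_1$,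 $\gamma\stackrel{\alpha_2}{\to}\gamma_2$ and $\gamma\stackrel{\alpha_1}{\to}\gamma_1\vdash_D\gamma\stackrel{\alpha_2}{\to}\gamma_3$, then $\gamma_3\in IS^\star$. For a partition $\mathcal P$ (viewed as an equivalence relation on $IS^\star$), $\gamma_1\,\mathbf{IR}(\mathcal P)\,\gamma_2$ holds iff $\gamma_1\,\mathcal P\,\gamma_2$, for every $\gamma_1\stackrel{\alpha}{\to}\gamma_1'$ irredundant in $\mathcal P$ there is $\gamma_2\stackrel{\alpha}{\to}\gamma_2'$ with $\gamma_1'\,\mathcal P\,\gamma_2'$, and the same holds with $\gamma_1,\gamma_2$ exchanged. CCP-Partition-Refinement computes $IS^\star$ by applying the rules (rs), (rd) repeatedly to $IS$ until nothing is added; starts from the partition $\mathcal P^0$ of $IS^\star$ in which two configurations are equivalent iff they have the same store; computes $\mathcal P^{n+1}=\mathbf{IR}(\mathcal P^n)$; and stops and returns $\mathcal P^n$ at the first $n$ with $\mathcal P^n=\mathcal P^{n+1}$. **Proposition.** Suppose that $IS^\star$ is finite. Then CCP-Partition-Refinement terminates: the computation of $IS^\star$ becomes stationary after at most $|IS^\star|$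 rounds, with the result $IS^\star$; every $\mathcal P^n$ is a partition of $IS^\star$; and there is a first $n$ with $\mathcal P^n=\mathcal P^{n+1}$, and it satisfies $n\le|IS^\star|$. The returned partition $\mathcal P^n$ coincides with $\dot\sim_{sb}$ on $IS^\star$: for all $\gamma_1,\gamma_2\in IS^\star$, $\gamma_1\,\mathcal P^n\,\gamma_2$ iff $\gamma_1\,\dot\sim_{sb}\,\gamma_2$. -/

import Mathlib

/-! ### Cylindric constraint systems

A constraint system is a complete algebraic lattice `Con` (`[CompleteLattice Con]`,
`[IsCompactlyGenerated Con]`): `≤` is the entailment order, `⊔` is the lub, `⊥` is `true`, `⊤` is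
`false`, and the finite elements are the compact ones. -/

namespace CCP

/-- The finite (compact) elements of the lattice of constraints. -/
abbrev FinCon (Con : Type*) [CompleteLattice Con] : Type _ := {c : Con // IsCompactElement c}

/-- Cylindric structure over the variables `V`: cylindrification operators (hiding) `ex x`, which
send finite elements to finite elements and are continuous, and finite diagonal elements
`diag x y` (equality of `x` and `y`). -/
structure Cylindric (V : Type*) (Con : Type*) [CompleteLattice Con] where
  ex : V → Con → Con
  diag : V → V → Con
  ex_le : ∀ x c, ex x c ≤ c
  ex_mono : ∀ x c d, c ≤ d → ex x c ≤ ex x d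
  ex_sup_ex : ∀ x c d, ex x (c ⊔ ex x d) = ex x c ⊔ ex x d
  ex_comm : ∀ x y c, ex x (ex y c) = ex y (ex x c)
  ex_compact : ∀ x c, IsCompactElement c → IsCompactElement (ex x c)
  ex_sSup : ∀ x (s : Set Con), s.Nonempty → DirectedOn (· ≤ ·) s → ex x (sSup s) = sSup (ex x '' s)
  diag_compact : ∀ x y, IsCompactElement (diag x y)
  diag_self : ∀ x, diag x x = ⊥
  diag_trans : ∀ x y z, z ≠ x → z ≠ y → diag x y = ex z (diag x z ⊔ diag z y)
  le_diag_sup : ∀ x y c, x ≠ y → c ≤ diag x y ⊔ ex x (c ⊔ diag x y)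

noncomputable section

open Classical in
/-- Substitution on constraints, `c[z/x] = ∃x (d_xz ⊔ c)` for `x ≠ z`. -/
def Cylindric.subst {V Con : Type*} [CompleteLattice Con] (C : Cylindric V Con)
    (x z : V) (c : Con) : Con :=
  if x = z then c else C.ex x (C.diag x z ⊔ c)

theorem compact_sup {Con : Type*} [CompleteLattice Con] {a b : Con}
    (ha : IsCompactElement a) (hb : IsCompactElement b) : IsCompactElement (a ⊔ b) := by
  classical
  have h := CompleteLattice.isCompactElement_finsetSup (α := Con) (f := id) ({a, b} : Finset Con)
    (by
      intro x hx
      simp only [Finset.mem_insert, Finset.mem_singleton] at hx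
      rcases hx with rfl | rfl
      · exact ha
      · exact hb)
  simpa using h

theorem Cylindric.subst_compact {V Con : Type*} [CompleteLattice Con] (C : Cylindric V Con)
    (x z : V) {c : Con} (hc : IsCompactElement c) : IsCompactElement (C.subst x z c) := by
  unfold Cylindric.subst
  split_ifs
  · exact hc
  · exact C.ex_compact _ _ (compact_sup (C.diag_compact _ _) hc)

/-- Substitution on finite constraints. -/
def Cylindric.substFin {V Con : Type*} [CompleteLattice Con] (C : Cylindric V Con)
    (x z : V) (c : FinCon Con) : FinCon Con :=
  ⟨C.subst x z c.1, C.subst_compact x z c.2⟩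

/-- The free variables of a constraint. -/
def Cylindric.fv {V Con : Type*} [CompleteLattice Con] (C : Cylindric V Con) (c : Con) : Set V :=
  {x | C.ex x c ≠ c}

/-! ### Fresh variables and sequences of renamings -/

open Classical in
/-- The least variable (for a fixed well-ordering of the variables) outside of `A`;
`v` if there is none. -/
def fresh {V : Type*} (A : Set V) (v : V) : V :=
  if h : (Aᶜ).Nonempty then
    (WellOrderingRel.isWellOrder (α := V)).wf.min Aᶜ h
  else v

/-- As many distinct variables outside of `A` as there are entries in the given list. -/
def freshList {V : Type*} : List V → Set V → List V
  | [], _ => []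
  | x :: xs, A => fresh A x :: freshList xs (insert (fresh A x) A)

/-- A list of renamings `(x, z)` (of `x` into `z`), carried out one after the other from left to
right. -/
abbrev Ren (V : Type*) : Type _ := List (V × V)

/-- The variables that are mentioned in a list of renamings. -/
def Ren.vars {V : Type*} (r : Ren V) : Set V := {v | ∃ p ∈ r, v = p.1 ∨ v = p.2}

open Classical in
/-- Action of a list of renamings on variables. -/
def Ren.onVar {V : Type*} (r : Ren V) (v : V) : V :=
  r.foldl (fun w p => if w = p.1 then p.2 else w) v

/-- Action of a list of renamings on finite constraints. -/
def Ren.onCon {V Con : Type*} [CompleteLattice Con] (C : Cylindric V Con) (r : Ren V)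
    (c : FinCon Con) : FinCon Con :=
  r.foldl (fun b p => C.substFin p.1 p.2 b) c

/-! ### Processes -/

/-- The processes of ccp. `loc x e P` is the process `P` with the local variable `x` and the local
store `e`, and `call p z` is a procedure call; `ar p` is the number of parameters of the procedure
identifier `p`. -/
inductive Proc (V Con : Type*) [CompleteLattice Con] {I : Type*} (ar : I → ℕ) where
  | nil : Proc V Con ar
  | tell : FinCon Con → Proc V Con ar
  | ask : FinCon Con → Proc V Con ar → Proc V Con ar
  | par : Proc V Con ar → Proc V Con ar → Proc V Con ar
  | sum : Proc V Con ar → Proc V Con ar → Proc V Con ar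
  | loc : V → FinCon Con → Proc V Con ar → Proc V Con ar
  | call : (p : I) → (Fin (ar p) → V) → Proc V Con ar

section

variable {V Con : Type*} [CompleteLattice Con] {I : Type*} {ar : I → ℕ}

/-- The free variables of a process. -/
def Proc.fv (C : Cylindric V Con) : Proc V Con ar → Set V
  | .nil => ∅
  | .tell c => C.fv c.1
  | .ask c P => C.fv c.1 ∪ P.fv C
  | .par P Q => P.fv C ∪ Q.fv C
  | .sum P Q => P.fv C ∪ Q.fv C
  | .loc x e P => (C.fv e.1 ∪ P.fv C) \ {x}
  | .call _ z => Set.range z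

/-- The process contains no hiding operator. -/
def Proc.HidingFree : Proc V Con ar → Prop
  | .nil => True
  | .tell _ => True
  | .ask _ P => P.HidingFree
  | .par P Q => P.HidingFree ∧ Q.HidingFree
  | .sum P Q => P.HidingFree ∧ Q.HidingFree
  | .loc _ _ _ => False
  | .call _ _ => True

open Classical in
/-- Capture-avoiding action of a list of renamings on processes. A bound variable that is mentioned
in the list is first renamed into a fresh variable. -/
def Proc.rename (C : Cylindric V Con) : Ren V → Proc V Con ar → Proc V Con ar
  | _, .nil => .nil
  | r, .tell c => .tell (r.onCon C c)
  | r, .ask c P => .ask (r.onCon C c) (P.rename C r)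
  | r, .par P Q => .par (P.rename C r) (Q.rename C r)
  | r, .sum P Q => .sum (P.rename C r) (Q.rename C r)
  | r, .loc y e P =>
      if y ∈ r.vars then
        let w := fresh (r.vars ∪ ((C.fv e.1 ∪ P.fv C) \ {y})) y
        .loc w (Ren.onCon C ((y, w) :: r) e) (P.rename C ((y, w) :: r))
      else .loc y (r.onCon C e) (P.rename C r)
  | r, .call p z => .call p (fun i => r.onVar (z i))

/-- `P[z/x]`. -/
def Proc.subst (C : Cylindric V Con) (x z : V) (P : Proc V Con ar) : Proc V Con ar :=
  P.rename C [(x, z)]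

/-- The simultaneous substitution `P[z₁…zₘ/x₁…xₘ]` (for distinct `x₁…xₘ`), through intermediate
fresh variables. -/
def Proc.substMany (C : Cylindric V Con) (xs zs : List V) (P : Proc V Con ar) : Proc V Con ar :=
  let us := freshList xs (P.fv C ∪ {v | v ∈ xs} ∪ {v | v ∈ zs})
  P.rename C (xs.zip us ++ us.zip zs)

/-- For every procedure identifier `p` its unique, possibly recursive, definition
`p(x₁…xₘ) := P` with `fv P ⊆ {x₁,…,xₘ}`. -/
structure ProcDefs (C : Cylindric V Con) (ar : I → ℕ) where
  params : (p : I) → Fin (ar p) → V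
  params_injective : ∀ p, Function.Injective (params p)
  body : I → Proc V Con ar
  fv_body : ∀ p, (body p).fv C ⊆ Set.range (params p)

/-- The body of the procedure `p`, called with the actual parameters `z`. -/
def ProcDefs.unfold {C : Cylindric V Con} (D : ProcDefs C ar) (p : I) (z : Fin (ar p) → V) :
    Proc V Con ar :=
  (D.body p).substMany C (List.ofFn (D.params p)) (List.ofFn z)

end

/-- Configurations: a process together with a global store. -/
structure Conf (V Con : Type*) [CompleteLattice Con] {I : Type*} (ar : I → ℕ) where
  proc : Proc V Con ar
  store : Con

section

variable {V Con : Type*} [CompleteLattice Con] {I : Type*} {ar : I → ℕ}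

/-! ### Reduction semantics and saturated barbed bisimilarity -/

/-- The (unlabelled) reduction relation. -/
inductive Red (C : Cylindric V Con) (D : ProcDefs C ar) : Conf V Con ar → Conf V Con ar → Prop
  | tell (c : FinCon Con) (d : Con) : Red C D ⟨.tell c, d⟩ ⟨.nil, d ⊔ c.1⟩
  | ask (c : FinCon Con) (P : Proc V Con ar) (d : Con) :
      c.1 ≤ d → Red C D ⟨.ask c P, d⟩ ⟨P, d⟩
  | parL (P P' Q : Proc V Con ar) (d d' : Con) :
      Red C D ⟨P, d⟩ ⟨P', d'⟩ → Red C D ⟨.par P Q, d⟩ ⟨.par P' Q, d'⟩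
  | parR (P Q Q' : Proc V Con ar) (d d' : Con) :
      Red C D ⟨Q, d⟩ ⟨Q', d'⟩ → Red C D ⟨.par P Q, d⟩ ⟨.par P Q', d'⟩
  | sumL (P P' Q : Proc V Con ar) (d d' : Con) :
      Red C D ⟨P, d⟩ ⟨P', d'⟩ → Red C D ⟨.sum P Q, d⟩ ⟨P', d'⟩
  | sumR (P Q Q' : Proc V Con ar) (d d' : Con) :
      Red C D ⟨Q, d⟩ ⟨Q', d'⟩ → Red C D ⟨.sum P Q, d⟩ ⟨Q', d'⟩
  | loc (x : V) (P P' : Proc V Con ar) (e e' : FinCon Con) (d : Con) :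
      Red C D ⟨P, e.1 ⊔ C.ex x d⟩ ⟨P', e'.1 ⊔ C.ex x d⟩ →
      Red C D ⟨.loc x e P, d⟩ ⟨.loc x e' P', d ⊔ C.ex x e'.1⟩
  | call (p : I) (z : Fin (ar p) → V) (d : Con) (γ : Conf V Con ar) :
      Red C D ⟨D.unfold p z, d⟩ γ → Red C D ⟨.call p z, d⟩ γ

/-- `γ` satisfies the barb `c`. -/
def Conf.Barb (γ : Conf V Con ar) (c : FinCon Con) : Prop := c.1 ≤ γ.store

/-- Addition of a constraint to the store. -/
def Conf.add (γ : Conf V Con ar) (a : Con) : Conf V Con ar := ⟨γ.proc, γ.store ⊔ a⟩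

/-- Saturated barbed bisimulations. -/
structure IsSatBarbedBisim (C : Cylindric V Con) (D : ProcDefs C ar)
    (R : Conf V Con ar → Conf V Con ar → Prop) : Prop where
  symm : ∀ γ₁ γ₂, R γ₁ γ₂ → R γ₂ γ₁
  barb : ∀ γ₁ γ₂, R γ₁ γ₂ → ∀ c : FinCon Con, γ₁.Barb c → γ₂.Barb c
  red : ∀ γ₁ γ₂, R γ₁ γ₂ → ∀ γ₁', Red C D γ₁ γ₁' → ∃ γ₂', Red C D γ₂ γ₂' ∧ R γ₁' γ₂'
  upward : ∀ γ₁ γ₂, R γ₁ γ₂ → ∀ a : FinCon Con, R (γ₁.add a.1) (γ₂.add a.1)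

/-- Saturated barbed bisimilarity. -/
def SatBarbedBisimilar (C : Cylindric V Con) (D : ProcDefs C ar) (γ₁ γ₂ : Conf V Con ar) : Prop :=
  ∃ R, IsSatBarbedBisim C D R ∧ R γ₁ γ₂

/-! ### Labelled semantics, derivation and redundancy -/

/-- The labelled transition relation; a label is a minimal finite constraint that the environment
has to add to the store for the reduction to be possible. -/
inductive Step (C : Cylindric V Con) (D : ProcDefs C ar) :
    Conf V Con ar → FinCon Con → Conf V Con ar → Prop
  | tell (c α : FinCon Con) (d : Con) :
      α.1 = ⊥ → Step C D ⟨.tell c, d⟩ α ⟨.nil, d ⊔ c.1⟩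
  | ask (c α : FinCon Con) (P : Proc V Con ar) (d : Con) :
      Minimal (fun a : FinCon Con => c.1 ≤ d ⊔ a.1) α →
      Step C D ⟨.ask c P, d⟩ α ⟨P, d ⊔ α.1⟩
  | parL (P P' Q : Proc V Con ar) (d d' : Con) (α : FinCon Con) :
      Step C D ⟨P, d⟩ α ⟨P', d'⟩ → Step C D ⟨.par P Q, d⟩ α ⟨.par P' Q, d'⟩
  | parR (P Q Q' : Proc V Con ar) (d d' : Con) (α : FinCon Con) :
      Step C D ⟨Q, d⟩ α ⟨Q', d'⟩ → Step C D ⟨.par P Q, d⟩ α ⟨.par P Q', d'⟩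
  | sumL (P P' Q : Proc V Con ar) (d d' : Con) (α : FinCon Con) :
      Step C D ⟨P, d⟩ α ⟨P', d'⟩ → Step C D ⟨.sum P Q, d⟩ α ⟨P', d'⟩
  | sumR (P Q Q' : Proc V Con ar) (d d' : Con) (α : FinCon Con) :
      Step C D ⟨Q, d⟩ α ⟨Q', d'⟩ → Step C D ⟨.sum P Q, d⟩ α ⟨Q', d'⟩
  | loc (x z : V) (P P' : Proc V Con ar) (e e' α : FinCon Con) (d : Con) :
      x ∉ C.fv e'.1 → z ∉ P.fv C → z ∉ C.fv (e.1 ⊔ d ⊔ α.1) →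
      Step C D ⟨P.subst C x z, (C.substFin x z e).1 ⊔ d⟩ α ⟨P', e'.1 ⊔ d ⊔ α.1⟩ →
      Step C D ⟨.loc x e P, d⟩ α
        ⟨.loc x (C.substFin z x e') (P'.subst C z x),
          C.ex x (C.substFin z x e').1 ⊔ d ⊔ α.1⟩
  | call (p : I) (z : Fin (ar p) → V) (d : Con) (α : FinCon Con) (γ : Conf V Con ar) :
      Step C D ⟨D.unfold p z, d⟩ α γ → Step C D ⟨.call p z, d⟩ α γ

/-- `Derives γ α γ₁ β γ₂`: the transition from `γ` to `γ₁` with label `α` derives the transition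
from `γ` to `γ₂` with label `β`, where the latter need not be generated by the rules. -/
def Derives (C : Cylindric V Con) (D : ProcDefs C ar) (γ : Conf V Con ar) (α : FinCon Con)
    (γ₁ : Conf V Con ar) (β : FinCon Con) (γ₂ : Conf V Con ar) : Prop :=
  Step C D γ α γ₁ ∧ γ₂.proc = γ₁.proc ∧
    ∃ e : Con, β.1 = α.1 ⊔ e ∧ γ₂.store = γ₁.store ⊔ e ∧ α ≠ β

/-- The transition from `γ` to `γ₁` with label `α` dominates in `R` the one from `γ` to `γ₂` with
label `β`. -/
def Dominates (C : Cylindric V Con) (D : ProcDefs C ar)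
    (R : Conf V Con ar → Conf V Con ar → Prop) (γ : Conf V Con ar) (α : FinCon Con)
    (γ₁ : Conf V Con ar) (β : FinCon Con) (γ₂ : Conf V Con ar) : Prop :=
  Step C D γ α γ₁ ∧ Step C D γ β γ₂ ∧ ∃ γ₂', Derives C D γ α γ₁ β γ₂' ∧ R γ₂' γ₂

/-- The transition from `γ` to `γ₂` with label `β` is irredundant with respect to `R`. -/
def Irredundant (C : Cylindric V Con) (D : ProcDefs C ar)
    (R : Conf V Con ar → Conf V Con ar → Prop) (γ : Conf V Con ar) (β : FinCon Con)
    (γ₂ : Conf V Con ar) : Prop :=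
  Step C D γ β γ₂ ∧ ¬ ∃ α γ₁, Dominates C D R γ α γ₁ β γ₂

/-! ### The algorithm -/

/-- The closure `IS⋆` of the initial configurations. -/
inductive Closure (C : Cylindric V Con) (D : ProcDefs C ar) (IS : Set (Conf V Con ar)) :
    Conf V Con ar → Prop
  | is (γ : Conf V Con ar) : γ ∈ IS → Closure C D IS γ
  | rs (γ₁ γ₂ : Conf V Con ar) (α : FinCon Con) :
      Closure C D IS γ₁ → Step C D γ₁ α γ₂ → Closure C D IS γ₂
  | rd (γ γ₁ γ₂ γ₃ : Conf V Con ar) (α₁ α₂ : FinCon Con) :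
      Closure C D IS γ → Step C D γ α₁ γ₁ → Step C D γ α₂ γ₂ →
      Derives C D γ α₁ γ₁ α₂ γ₃ → Closure C D IS γ₃

/-- `IS⋆` as a set. -/
def ISstar (C : Cylindric V Con) (D : ProcDefs C ar) (IS : Set (Conf V Con ar)) :
    Set (Conf V Con ar) := {γ | Closure C D IS γ}

/-- The stages of the computation of `IS⋆`: start from `IS` and repeatedly add everything that the
rules (rs) and (rd) produce in one application. -/
def closureStage (C : Cylindric V Con) (D : ProcDefs C ar) (IS : Set (Conf V Con ar)) :
    ℕ → Set (Conf V Con ar)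
  | 0 => IS
  | n + 1 =>
      closureStage C D IS n
        ∪ {γ₂ | ∃ γ₁ ∈ closureStage C D IS n, ∃ α, Step C D γ₁ α γ₂}
        ∪ {γ₃ | ∃ γ ∈ closureStage C D IS n, ∃ α₁ γ₁ α₂ γ₂, Step C D γ α₁ γ₁ ∧ Step C D γ α₂ γ₂ ∧
            Derives C D γ α₁ γ₁ α₂ γ₃}

/-- `R` is an equivalence relation on `S` that relates nothing outside of `S`; such relations
represent the partitions of `S` (two elements are related iff they are in the same block). -/
structure IsPartitionRel {X : Type*} (S : Set X) (R : X → X → Prop) : Prop where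
  mem : ∀ a b, R a b → a ∈ S ∧ b ∈ S
  refl : ∀ a ∈ S, R a a
  symm : ∀ a b, R a b → R b a
  trans : ∀ a b c, R a b → R b c → R a c

/-- Every irredundant (in `P`) transition of `γ₁` is matched by `γ₂`, up to `P`. -/
def Matches (C : Cylindric V Con) (D : ProcDefs C ar)
    (P : Conf V Con ar → Conf V Con ar → Prop) (γ₁ γ₂ : Conf V Con ar) : Prop :=
  ∀ α γ₁', Irredundant C D P γ₁ α γ₁' → ∃ γ₂', Step C D γ₂ α γ₂' ∧ P γ₁' γ₂'

/-- The refinement `IR(P)`: a block of `P` is split according to the irredundant transitions. -/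
def IR (C : Cylindric V Con) (D : ProcDefs C ar)
    (P : Conf V Con ar → Conf V Con ar → Prop) (γ₁ γ₂ : Conf V Con ar) : Prop :=
  P γ₁ γ₂ ∧ Matches C D P γ₁ γ₂ ∧ Matches C D P γ₂ γ₁

/-- The partitions of `IS⋆` that the algorithm computes: the first one is the partition by store,
and each one is refined by `IR` into the next. -/
def part (C : Cylindric V Con) (D : ProcDefs C ar) (IS : Set (Conf V Con ar)) :
    ℕ → Conf V Con ar → Conf V Con ar → Prop
  | 0 => fun γ₁ γ₂ => γ₁ ∈ ISstar C D IS ∧ γ₂ ∈ ISstar C D IS ∧ γ₁.store = γ₂.store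
  | n + 1 => IR C D (part C D IS n)

/-- The loop of the algorithm stops at `n`, that is, `n` is the first index for which the `n`-th
partition agrees with the next one; the `n`-th partition is the one that is returned. -/
def StopsAt (C : Cylindric V Con) (D : ProcDefs C ar) (IS : Set (Conf V Con ar)) (n : ℕ) : Prop :=
  part C D IS n = part C D IS (n + 1) ∧ ∀ m < n, part C D IS m ≠ part C D IS (m + 1)

end

end

end CCP

namespace CCP

/-! Over infinitely many variables, well-foundedness of `Con` makes the cylindric structure trivial:
all diagonal elements are `⊥` and every `C.ex x` is the identity
(`Cylindric.isTrivial_of_wellFoundedLT`). So under either hypothesis hiding is harmless: it merely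
keeps a local store, or it does not occur. The renamings and local stores that are left are absorbed
by the relation `Sim`. Up to `Sim`, a reduction of `γ` with `a` added to its store is the same as a
transition of `γ` with a label `α ≤ a`, with `a` added to the target (`Step.sound`, `Red.complete`).

The partitions are compared with approximants `approx` of bisimilarity that live on all
configurations and test all added constraints. On `IS⋆` the two agree at every level
(`part_iff_approx`). In one direction, every transition lies above an irredundant one, so matching
the irredundant ones matches all reductions. In the other, an irredundant transition answered only
with a smaller label could be answered back, and would then be dominated; rule (rd) ensures that the
configuration needed for this domination belongs to `IS⋆`.

Bisimilarity is contained in all approximants, and a stable partition generates a saturated barbed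
bisimulation (`satBarbedBisimilar_of_stable`). Termination is a count of configurations and of
blocks. -/

theorem compact_bot {Con : Type*} [CompleteLattice Con] : IsCompactElement (⊥ : Con) := by
  simpa using CompleteLattice.isCompactElement_finsetSup (α := Con) (f := id) ∅ (by simp)

/-! ### Cylindric algebra -/

namespace Cylindric

variable {V Con : Type*} [CompleteLattice Con] (C : Cylindric V Con)

theorem ex_bot (x : V) : C.ex x ⊥ = ⊥ := le_bot_iff.1 (C.ex_le x ⊥)

theorem ex_ex (x : V) (c : Con) : C.ex x (C.ex x c) = C.ex x c := by
  simpa [C.ex_bot] using C.ex_sup_ex x ⊥ c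

theorem ex_sup_of_ex_eq {x : V} {c d : Con} (hd : C.ex x d = d) :
    C.ex x (c ⊔ d) = C.ex x c ⊔ d := by
  simpa [hd] using C.ex_sup_ex x c d

theorem ex_diag_of_ne {x y z : V} (hx : z ≠ x) (hy : z ≠ y) :
    C.ex z (C.diag x y) = C.diag x y := by
  rw [C.diag_trans x y z hx hy, C.ex_ex]

/-- By `diag_trans`, `⊥ = diag x x` is the cylindrification by `z` of a join with `diag x z` as one
of its terms. -/
theorem ex_diag_right {x z : V} (h : z ≠ x) : C.ex z (C.diag x z) = ⊥ :=
  le_bot_iff.1 <| by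
    rw [← C.diag_self x, C.diag_trans x x z h h]
    exact C.ex_mono _ _ _ le_sup_left

theorem ex_diag_left {x z : V} (h : z ≠ x) : C.ex z (C.diag z x) = ⊥ :=
  le_bot_iff.1 <| by
    rw [← C.diag_self x, C.diag_trans x x z h h]
    exact C.ex_mono _ _ _ le_sup_right

theorem ex_finsetSup {ι : Type*} {x : V} (F : Finset ι) {w : ι → Con}
    (h : ∀ i ∈ F, C.ex x (w i) = w i) : C.ex x (F.sup w) = F.sup w := by
  classical
  induction F using Finset.induction_on with
  | empty => simpa using C.ex_bot x
  | insert j F hj ih =>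
    have hF := ih fun i hi => h i (Finset.mem_insert_of_mem hi)
    rw [Finset.sup_insert, C.ex_sup_of_ex_eq hF, h j (Finset.mem_insert_self j F)]

/-- Hiding the variables `u i` in an upper bound of an element that does not depend on them. -/
theorem le_of_le_sup_finsetSup {ι : Type*} {u : ι → V} {w : ι → Con} {b c : Con}
    (hw : ∀ i, C.ex (u i) (w i) ≤ b) (hwu : ∀ i j, i ≠ j → C.ex (u i) (w j) = w j)
    (hb : ∀ i, C.ex (u i) b = b) (F : Finset ι) (hc : ∀ i ∈ F, C.ex (u i) c = c)
    (h : c ≤ b ⊔ F.sup w) : c ≤ b := by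
  classical
  induction F using Finset.induction_on with
  | empty => simpa using h
  | insert j F hj ih =>
    refine ih (fun i hi => hc i (Finset.mem_insert_of_mem hi)) ?_
    have hF : C.ex (u j) (F.sup w) = F.sup w :=
      C.ex_finsetSup F fun i hi => hwu j i fun hji => hj (hji ▸ hi)
    have hbF : C.ex (u j) (b ⊔ F.sup w) = b ⊔ F.sup w := by rw [C.ex_sup_of_ex_eq hF, hb]
    calc c = C.ex (u j) c := (hc j (Finset.mem_insert_self j F)).symm
      _ ≤ C.ex (u j) (w j ⊔ (b ⊔ F.sup w)) := C.ex_mono _ _ _ <| by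
          rwa [Finset.sup_insert, sup_left_comm] at h
      _ = C.ex (u j) (w j) ⊔ (b ⊔ F.sup w) := C.ex_sup_of_ex_eq hbF
      _ ≤ b ⊔ F.sup w := sup_le ((hw j).trans le_sup_left) le_rfl

/-- No constraint depends on any variable. -/
def IsTrivial : Prop := ∀ x c, C.ex x c = c

variable {C}

theorem IsTrivial.diag_eq_bot (hC : C.IsTrivial) (x y : V) : C.diag x y = ⊥ := by
  rcases eq_or_ne y x with rfl | h
  · exact C.diag_self y
  · rw [← C.ex_diag_right h, hC]

theorem IsTrivial.substFin (hC : C.IsTrivial) (x z : V) (c : FinCon Con) :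
    C.substFin x z c = c := by
  apply Subtype.ext
  simp [Cylindric.substFin, Cylindric.subst, hC x, hC.diag_eq_bot]

theorem IsTrivial.onCon (hC : C.IsTrivial) (r : Ren V) (c : FinCon Con) : r.onCon C c = c := by
  unfold Ren.onCon
  induction r with
  | nil => rfl
  | cons p r ih => rw [List.foldl_cons, hC.substFin, ih]

theorem IsTrivial.fv (hC : C.IsTrivial) (c : Con) : C.fv c = ∅ := by
  ext x
  simp [Cylindric.fv, hC x]

variable (C)

/-- Over infinitely many variables, the diagonal elements of a cylindric structure on a
well-founded lattice are trivial, for otherwise the suprema of the tails of a sequence of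
independent diagonal elements would form an infinite descending chain. -/
theorem diag_eq_bot_of_wellFoundedLT [Infinite V] [WellFoundedLT Con] {x y : V} (hxy : x ≠ y) :
    C.diag x y = ⊥ := by
  have hinf : Infinite (({x, y} : Set V)ᶜ : Set V) :=
    (Set.Finite.infinite_compl (Set.toFinite {x, y})).to_subtype
  let f := Infinite.natEmbedding (({x, y} : Set V)ᶜ : Set V)
  let u : ℕ → V := fun i => (f i).1
  have hu : Function.Injective u := Subtype.val_injective.comp f.injective
  have hux (i) : u i ≠ x := fun h => (f i).2 (by simp [u, ← h])
  have huy (i) : u i ≠ y := fun h => (f i).2 (by simp [u, ← h])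
  let w : ℕ → Con := fun i => C.diag x (u i) ⊔ C.diag (u i) y
  have hw (i) : C.ex (u i) (w i) = C.diag x y := (C.diag_trans x y (u i) (hux i) (huy i)).symm
  have hwu (i j) (hij : i ≠ j) : C.ex (u i) (w j) = w j := by
    have hne : u i ≠ u j := fun h => hij (hu h)
    have h1 := C.ex_diag_of_ne (hux i) hne
    have h2 := C.ex_diag_of_ne hne (huy i)
    change C.ex (u i) (_ ⊔ _) = _ ⊔ _
    rw [C.ex_sup_of_ex_eq h2, h1]
  have hb (i) : C.ex (u i) (C.diag x y) = C.diag x y := C.ex_diag_of_ne (hux i) (huy i)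
  -- The suprema of the tails descend, so by well-foundedness two consecutive ones agree.
  let s : ℕ → Con := fun n => ⨆ i : Set.Ici n, w i
  have hs : Antitone s := fun m n hmn =>
    iSup_le fun i => le_iSup (fun i : Set.Ici m => w i) ⟨i.1, le_trans hmn i.2⟩
  obtain ⟨n, hn⟩ : ∃ n, s n = s (n + 1) := by
    obtain ⟨_, ⟨n, rfl⟩, hmin⟩ := WellFounded.has_min (wellFounded_lt (α := Con)) (Set.range s)
      (Set.range_nonempty s)
    exact ⟨n, ((hs n.le_succ).eq_of_not_lt (hmin _ ⟨n + 1, rfl⟩)).symm⟩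
  have hcompact : IsCompactElement (w n) := compact_sup (C.diag_compact _ _) (C.diag_compact _ _)
  have hle : w n ≤ s (n + 1) :=
    hn ▸ le_iSup (fun i : Set.Ici n => w i) ⟨n, Set.mem_Ici.2 le_rfl⟩
  -- By compactness finitely many later `w i` already cover `w n`; hiding their `u i`, on which `w
  -- n` does not depend, turns each of them into `diag x y`.
  obtain ⟨F, hF⟩ := CompleteLattice.IsCompactElement.exists_finset_of_le_iSup Con hcompact
    (fun i : Set.Ici (n + 1) => w i) hle
  have hwn : w n ≤ C.diag x y := by
    refine C.le_of_le_sup_finsetSup (u := fun i : Set.Ici (n + 1) => u i) (w := fun i => w i)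
      (fun i => (hw i).le) (fun i j hij => hwu i j fun h => hij (Subtype.ext h)) (fun i => hb i)
      F (fun i _ => hwu i n (Nat.ne_of_gt i.2)) (hF.trans ?_)
    rw [Finset.sup_eq_iSup]
    exact le_sup_right
  -- Hiding `y` fixes `diag x (u n)` but sends its upper bound `diag x y` to `⊥`; for `h2` the
  -- variable `x` is hidden instead.
  have h1 : C.diag x (u n) = ⊥ := le_bot_iff.1 <| by
    rw [← C.ex_diag_right hxy.symm, ← C.ex_diag_of_ne hxy.symm (huy n).symm]
    exact C.ex_mono _ _ _ (le_sup_left.trans hwn)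
  have h2 : C.diag (u n) y = ⊥ := le_bot_iff.1 <| by
    rw [← C.ex_diag_left hxy, ← C.ex_diag_of_ne (hux n).symm hxy]
    exact C.ex_mono _ _ _ (le_sup_right.trans hwn)
  rw [← hw n]
  simp [w, h1, h2, C.ex_bot]

theorem isTrivial_of_wellFoundedLT [Infinite V] [WellFoundedLT Con] : C.IsTrivial := by
  intro x c
  obtain ⟨y, hy⟩ := exists_ne x
  refine le_antisymm (C.ex_le x c) ?_
  simpa [C.diag_eq_bot_of_wellFoundedLT hy.symm] using C.le_diag_sup x y c hy.symm

end Cylindric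

/-! ### Similarity of processes relative to a store -/

section

variable {V Con : Type*} [CompleteLattice Con] {I : Type*} {ar : I → ℕ}

/-- `Sim C d P Q`: the processes `P` and `Q` have the same structure and, relative to the store
`d`, the same local stores; variables may differ, and hiding may occur, only if no constraint
depends on any variable. -/
inductive Sim (C : Cylindric V Con) : Con → Proc V Con ar → Proc V Con ar → Prop
  | nil (d : Con) : Sim C d .nil .nil
  | tell (d : Con) (c : FinCon Con) : Sim C d (.tell c) (.tell c)
  | ask (d : Con) (c : FinCon Con) (P Q : Proc V Con ar) :
      Sim C d P Q → Sim C d (.ask c P) (.ask c Q)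
  | par (d : Con) (P P' Q Q' : Proc V Con ar) :
      Sim C d P Q → Sim C d P' Q' → Sim C d (.par P P') (.par Q Q')
  | sum (d : Con) (P P' Q Q' : Proc V Con ar) :
      Sim C d P Q → Sim C d P' Q' → Sim C d (.sum P P') (.sum Q Q')
  | loc (d : Con) (x y : V) (e e' : FinCon Con) (P Q : Proc V Con ar) :
      C.IsTrivial → e.1 ⊔ d = e'.1 ⊔ d → Sim C (e.1 ⊔ d) P Q →
      Sim C d (.loc x e P) (.loc y e' Q)
  | call (d : Con) (p : I) (z z' : Fin (ar p) → V) :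
      C.IsTrivial ∨ z = z' → Sim C d (.call p z) (.call p z')

variable {C : Cylindric V Con}

theorem Sim.mono {d d' : Con} {P Q : Proc V Con ar} (h : Sim C d P Q) (hd : d ≤ d') :
    Sim C d' P Q := by
  induction h generalizing d' with
  | nil => exact .nil _
  | tell => exact .tell _ _
  | ask _ _ _ _ _ ih => exact .ask _ _ _ _ (ih hd)
  | par _ _ _ _ _ _ _ ih ih' => exact .par _ _ _ _ _ (ih hd) (ih' hd)
  | sum _ _ _ _ _ _ _ ih ih' => exact .sum _ _ _ _ _ (ih hd) (ih' hd)
  | loc d x y e e' P Q hC he _ ih =>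
    refine .loc _ _ _ _ _ _ _ hC ?_ (ih (sup_le_sup_left hd _))
    rw [← sup_eq_right.2 hd, ← sup_assoc, he, sup_assoc]
  | call _ _ _ _ h => exact .call _ _ _ _ h

theorem Sim.symm {d : Con} {P Q : Proc V Con ar} (h : Sim C d P Q) : Sim C d Q P := by
  induction h with
  | nil => exact .nil _
  | tell => exact .tell _ _
  | ask _ _ _ _ _ ih => exact .ask _ _ _ _ ih
  | par _ _ _ _ _ _ _ ih ih' => exact .par _ _ _ _ _ ih ih'
  | sum _ _ _ _ _ _ _ ih ih' => exact .sum _ _ _ _ _ ih ih'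
  | loc d x y e e' P Q hC he _ ih => exact .loc _ _ _ _ _ _ _ hC he.symm (he ▸ ih)
  | call _ _ _ _ h => exact .call _ _ _ _ (h.imp_right Eq.symm)

theorem Sim.trans {d : Con} {P Q R : Proc V Con ar} (h : Sim C d P Q) (h' : Sim C d Q R) :
    Sim C d P R := by
  induction h generalizing R with
  | nil => exact h'
  | tell => exact h'
  | ask _ _ _ _ _ ih => cases h' with | ask _ _ _ _ h => exact .ask _ _ _ _ (ih h)
  | par _ _ _ _ _ _ _ ih ih' =>
    cases h' with | par _ _ _ _ _ h h' => exact .par _ _ _ _ _ (ih h) (ih' h')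
  | sum _ _ _ _ _ _ _ ih ih' =>
    cases h' with | sum _ _ _ _ _ h h' => exact .sum _ _ _ _ _ (ih h) (ih' h')
  | loc d x y e e' P Q hC he _ ih =>
    cases h' with
    | loc _ _ _ _ _ _ _ _ he' h =>
      exact .loc _ _ _ _ _ _ _ hC (he.trans he') (ih (he.symm ▸ h))
  | call _ _ _ _ h =>
    cases h' with
    | call _ _ _ _ h' =>
      refine .call _ _ _ _ ?_
      rcases h with h | rfl
      · exact .inl h
      · exact h'

/-- In a trivial structure substitution fixes every constraint, so only the names of variables
change, and `Sim` ignores these. -/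
theorem Sim.rename (hC : C.IsTrivial) (r : Ren V) (d : Con) (P : Proc V Con ar) :
    Sim C d P (P.rename C r) := by
  induction P generalizing r d with
  | nil => exact .nil _
  | tell c =>
    rw [Proc.rename, hC.onCon]
    exact .tell _ _
  | ask c P ih =>
    rw [Proc.rename, hC.onCon]
    exact .ask _ _ _ _ (ih _ _)
  | par P Q ih ih' => exact .par _ _ _ _ _ (ih _ _) (ih' _ _)
  | sum P Q ih ih' => exact .sum _ _ _ _ _ (ih _ _) (ih' _ _)
  | loc x e P ih =>
    simp only [Proc.rename, hC.onCon]
    split_ifs <;> exact .loc _ _ _ _ _ _ _ hC rfl (ih _ _)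
  | call p z => exact .call _ _ _ _ (.inl hC)

/-- Reflexivity is not automatic, since `Sim` relates hiding processes only over a trivial
structure. There it follows by renaming with the empty list and going back. -/
theorem Sim.refl {P : Proc V Con ar} (h : C.IsTrivial ∨ P.HidingFree) (d : Con) :
    Sim C d P P := by
  rcases h with hC | h
  · exact (Sim.rename hC [] d P).trans (Sim.rename hC [] d P).symm
  · induction P with
    | nil => exact .nil _
    | tell c => exact .tell _ _
    | ask c P ih => exact .ask _ _ _ _ (ih h)
    | par P Q ih ih' => exact .par _ _ _ _ _ (ih h.1) (ih' h.2)
    | sum P Q ih ih' => exact .sum _ _ _ _ _ (ih h.1) (ih' h.2)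
    | loc x e P ih => exact h.elim
    | call p z => exact .call _ _ _ _ (.inr rfl)

theorem Proc.HidingFree.rename {P : Proc V Con ar} (h : P.HidingFree) (r : Ren V) :
    (P.rename C r).HidingFree := by
  induction P with
  | nil => trivial
  | tell c => trivial
  | ask c P ih => exact ih h
  | par P Q ih ih' => exact ⟨ih h.1, ih' h.2⟩
  | sum P Q ih ih' => exact ⟨ih h.1, ih' h.2⟩
  | loc x e P ih => exact h.elim
  | call p z => trivial

/-- No constraint depends on any variable, or the procedure bodies contain no hiding. -/
def ProcDefs.Tame (D : ProcDefs C ar) : Prop := C.IsTrivial ∨ ∀ p, (D.body p).HidingFree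

theorem Sim.unfold {D : ProcDefs C ar} (hD : D.Tame) {p : I} {z z' : Fin (ar p) → V}
    (h : C.IsTrivial ∨ z = z') (d : Con) : Sim C d (D.unfold p z) (D.unfold p z') := by
  rcases h with hC | rfl
  · exact (Sim.rename hC _ d _).symm.trans (Sim.rename hC _ d _)
  · exact Sim.refl (hD.imp_right fun h => (h p).rename _) d

/-! ### Soundness and completeness of the labelled semantics -/

variable {D : ProcDefs C ar}

/-- Compactness of the increment `k` matters: in `Red.complete` it becomes part of a local store,
which has to be finite. -/
theorem Step.exists_store_eq {γ γ' : Conf V Con ar} {α : FinCon Con} (h : Step C D γ α γ') :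
    ∃ k : FinCon Con, γ'.store = γ.store ⊔ α.1 ⊔ k.1 := by
  induction h with
  | tell c α d h => exact ⟨c, by simp [h]⟩
  | ask c α P d => exact ⟨⟨⊥, compact_bot⟩, by simp⟩
  | parL _ _ _ _ _ _ _ ih => exact ih
  | parR _ _ _ _ _ _ _ ih => exact ih
  | sumL _ _ _ _ _ _ _ ih => exact ih
  | sumR _ _ _ _ _ _ _ ih => exact ih
  | loc x z P P' e e' α d =>
    exact ⟨⟨_, C.ex_compact x _ (C.substFin z x e').2⟩, by rw [sup_assoc, sup_comm]⟩
  | call _ _ _ _ _ _ ih => exact ih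

theorem Step.store_sup_le {γ γ' : Conf V Con ar} {α : FinCon Con} (h : Step C D γ α γ') :
    γ.store ⊔ α.1 ≤ γ'.store := by
  obtain ⟨k, hk⟩ := h.exists_store_eq
  exact hk ▸ le_sup_left

/-- The labelled rule for hiding renames the bound variable and the reduction rule does not. Hence
the induction is over all `Q` similar to the source, not over the source alone. -/
theorem Step.sound (hD : D.Tame) {γ γ' : Conf V Con ar} {α : FinCon Con} (h : Step C D γ α γ')
    {a : Con} (ha : α.1 ≤ a) {Q : Proc V Con ar} (hQ : Sim C (γ.store ⊔ a) γ.proc Q) :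
    ∃ Q', Red C D ⟨Q, γ.store ⊔ a⟩ ⟨Q', γ'.store ⊔ a⟩ ∧ Sim C (γ'.store ⊔ a) γ'.proc Q' := by
  induction h generalizing a Q with
  | tell c α d h =>
    cases hQ
    refine ⟨.nil, ?_, .nil _⟩
    dsimp only
    rw [sup_right_comm]
    exact .tell _ _
  | ask c α P d h =>
    cases hQ with
    | ask _ _ _ Q hQ =>
      dsimp only at *
      have : d ⊔ α.1 ⊔ a = d ⊔ a := by rw [sup_assoc, sup_eq_right.2 ha]
      rw [this]
      exact ⟨Q, .ask _ _ _ (h.prop.trans (sup_le_sup_left ha d)), hQ⟩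
  | parL P P' R d d' α h ih =>
    cases hQ with
    | par _ _ _ Q R' h1 h2 =>
      obtain ⟨Q', hr, hs⟩ := ih ha h1
      exact ⟨_, .parL _ _ _ _ _ hr, .par _ _ _ _ _ hs
        (h2.mono (sup_le_sup_right (le_sup_left.trans h.store_sup_le) a))⟩
  | parR P P' R d d' α h ih =>
    cases hQ with
    | par _ _ _ Q R' h1 h2 =>
      obtain ⟨Q', hr, hs⟩ := ih ha h2
      exact ⟨_, .parR _ _ _ _ _ hr, .par _ _ _ _ _
        (h1.mono (sup_le_sup_right (le_sup_left.trans h.store_sup_le) a)) hs⟩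
  | sumL P P' R d d' α h ih =>
    cases hQ with
    | sum _ _ _ Q R' h1 h2 =>
      obtain ⟨Q', hr, hs⟩ := ih ha h1
      exact ⟨_, .sumL _ _ _ _ _ hr, hs⟩
  | sumR P P' R d d' α h ih =>
    cases hQ with
    | sum _ _ _ Q R' h1 h2 =>
      obtain ⟨Q', hr, hs⟩ := ih ha h2
      exact ⟨_, .sumR _ _ _ _ _ hr, hs⟩
  | loc x z P P' e e' α d _ _ _ _ ih =>
    cases hQ with
    | loc _ _ y _ e₂ _ Q hC he hPQ =>
      dsimp only at *
      rw [hC.substFin] at ih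
      obtain ⟨Q', hr, hs⟩ := ih ha
        ((sup_assoc e.1 d a).symm ▸ ((Sim.rename hC _ _ P).symm.trans hPQ))
      have hα : e'.1 ⊔ d ⊔ α.1 ⊔ a = d ⊔ a ⊔ e'.1 := by
        rw [sup_assoc, sup_eq_right.2 ha, sup_assoc, sup_comm]
      rw [hC.substFin, hC x, hα]
      rw [hα, sup_assoc, he, sup_comm (d ⊔ a)] at hr
      rw [hα] at hs
      -- The reduction fixes the new local store only up to the global one, so `e'` itself can
      -- serve.
      refine ⟨.loc y e' Q', ?_, .loc _ _ _ _ _ _ _ hC rfl ?_⟩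
      · have := Red.loc (D := D) y Q Q' e₂ e' (d ⊔ a)
        rw [hC, hC] at this
        exact this hr
      · exact (Sim.rename hC _ _ _).symm.trans (hs.mono le_sup_right)
  | call p z d α γ _ ih =>
    cases hQ with
    | call _ _ _ z' hz =>
      obtain ⟨Q', hr, hs⟩ := ih ha (Sim.unfold hD hz _)
      exact ⟨_, .call _ _ _ _ hr, hs⟩

theorem Proc.finite_fv (hC : C.IsTrivial) (P : Proc V Con ar) : (P.fv C).Finite := by
  induction P with
  | nil => exact Set.finite_empty
  | tell c => simp [Proc.fv, hC.fv]
  | ask c P ih => simpa [Proc.fv, hC.fv] using ih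
  | par P Q ih ih' => exact ih.union ih'
  | sum P Q ih ih' => exact ih.union ih'
  | loc x e P ih => exact (((hC.fv e.1).symm ▸ Set.finite_empty).union ih).sdiff
  | call p z => exact Set.finite_range z

theorem Red.store_le {γ γ' : Conf V Con ar} (h : Red C D γ γ') : γ.store ≤ γ'.store := by
  induction h with
  | tell => exact le_sup_left
  | ask => exact le_rfl
  | parL _ _ _ _ _ _ ih => exact ih
  | parR _ _ _ _ _ _ ih => exact ih
  | sumL _ _ _ _ _ _ ih => exact ih
  | sumR _ _ _ _ _ _ ih => exact ih
  | loc => exact le_sup_left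
  | call _ _ _ _ _ ih => exact ih

/-- Well-foundedness of the finite constraints gives, in the case of `ask`, a minimal label below
the constraint `a` that suffices. -/
theorem Red.complete [Infinite V] [WellFoundedLT (FinCon Con)] (hD : D.Tame)
    {γ γ' : Conf V Con ar} (h : Red C D γ γ') {d : Con} {a : FinCon Con} (hd : γ.store = d ⊔ a.1)
    {Q : Proc V Con ar} (hQ : Sim C γ.store γ.proc Q) :
    ∃ (α : FinCon Con) (δ : Conf V Con ar), α ≤ a ∧ Step C D ⟨Q, d⟩ α δ ∧
      γ'.store = δ.store ⊔ a.1 ∧ Sim C γ'.store γ'.proc δ.proc := by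
  induction h generalizing d a Q with
  | tell c d' =>
    cases hQ
    dsimp only at *
    refine ⟨⟨⊥, compact_bot⟩, ⟨.nil, d ⊔ c.1⟩, bot_le (a := a.1),
      .tell _ _ _ rfl, ?_, .nil _⟩
    rw [hd, sup_right_comm]
  | ask c P d' h =>
    cases hQ with
    | ask _ _ _ Q hQ =>
      dsimp only at *
      subst hd
      obtain ⟨α, hα, hmin⟩ := exists_minimal_le_of_wellFoundedLT
        (fun b : FinCon Con => c.1 ≤ d ⊔ b.1) a h
      refine ⟨α, ⟨Q, d ⊔ α.1⟩, hα, .ask _ _ _ _ hmin, ?_, hQ⟩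
      dsimp only
      rw [sup_assoc, sup_eq_right.2 (show α.1 ≤ a.1 from hα)]
  | parL P P' R d₁ d' h ih =>
    cases hQ with
    | par _ _ _ Q R' h1 h2 =>
      obtain ⟨α, δ, hα, hs, he, hS⟩ := ih hd h1
      exact ⟨α, ⟨.par δ.proc R', δ.store⟩, hα, .parL _ _ _ _ _ _ hs, he,
        .par _ _ _ _ _ hS (h2.mono h.store_le)⟩
  | parR P P' R d₁ d' h ih =>
    cases hQ with
    | par _ _ _ Q R' h1 h2 =>
      obtain ⟨α, δ, hα, hs, he, hS⟩ := ih hd h2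
      exact ⟨α, ⟨.par Q δ.proc, δ.store⟩, hα, .parR _ _ _ _ _ _ hs, he,
        .par _ _ _ _ _ (h1.mono h.store_le) hS⟩
  | sumL P P' R d₁ d' h ih =>
    cases hQ with
    | sum _ _ _ Q R' h1 h2 =>
      obtain ⟨α, δ, hα, hs, he, hS⟩ := ih hd h1
      exact ⟨α, δ, hα, .sumL _ _ _ _ _ _ hs, he, hS⟩
  | sumR P P' R d₁ d' h ih =>
    cases hQ with
    | sum _ _ _ Q R' h1 h2 =>
      obtain ⟨α, δ, hα, hs, he, hS⟩ := ih hd h2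
      exact ⟨α, δ, hα, .sumR _ _ _ _ _ _ hs, he, hS⟩
  | loc x P P' e e' d' h ih =>
    cases hQ with
    | loc _ _ y _ e₂ _ Q hC he hPQ =>
      dsimp only at *
      subst hd
      rw [hC] at ih
      rw [hC]
      -- Triviality leaves only finitely many free variables in `Q`, so a fresh one exists.
      obtain ⟨z, hz⟩ := (Q.finite_fv hC).exists_notMem
      obtain ⟨α, δ, hα, hs, hst, hS⟩ := ih (d := e₂.1 ⊔ d) (a := a)
        (by rw [he, sup_assoc]) (hPQ.trans (Sim.rename hC [(y, z)] _ Q))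
      obtain ⟨k, hk⟩ := hs.exists_store_eq
      dsimp only at hk
      -- The rule for hiding wants the target store split as local store, `d` and label; the
      -- increment `k` is counted as local.
      let e₃ : FinCon Con := ⟨e₂.1 ⊔ k.1, compact_sup e₂.2 k.2⟩
      have hδ : δ.store = e₃.1 ⊔ d ⊔ α.1 := by
        rw [hk]
        simp only [e₃, sup_comm, sup_left_comm]
      have hstep := Step.loc (D := D) y z Q δ.proc e₂ e₃ α d (by simp [hC.fv]) hz (by simp [hC.fv])
        (by rw [hC.substFin, ← hδ]; exact hs)
      rw [hC.substFin, hC, ← hδ] at hstep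
      refine ⟨α, _, hα, hstep, ?_, .loc _ _ _ _ _ _ _ hC ?_ ?_⟩
      · rw [← hst, sup_comm]
      · have hδa : δ.store ⊔ a.1 = e₃.1 ⊔ (d ⊔ a.1) := by
          rw [hδ, sup_assoc, sup_eq_right.2 (show α.1 ≤ a.1 from hα), sup_assoc]
        rw [sup_comm _ e'.1, ← sup_assoc, sup_idem, hst, hδa, ← sup_assoc e₃.1 e₃.1,
          sup_idem]
      · exact (hS.trans (Sim.rename hC _ _ _)).mono
          (by rw [sup_comm (d ⊔ a.1)]; exact le_sup_right)
  | call p z d' γ _ ih =>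
    cases hQ with
    | call _ _ _ z' hz =>
      obtain ⟨α, δ, hα, hs, he, hS⟩ := ih hd (Sim.unfold hD hz _)
      exact ⟨α, δ, hα, .call _ _ _ _ _ hs, he, hS⟩

end
end CCP

namespace CCP

section

variable {V Con : Type*} [CompleteLattice Con] {I : Type*} {ar : I → ℕ}
  {C : Cylindric V Con} {D : ProcDefs C ar}

/-! ### Adequacy of the labelled semantics on configurations -/

/-- Similarity of configurations. -/
def Conf.Sim (C : Cylindric V Con) (γ δ : Conf V Con ar) : Prop :=
  γ.store = δ.store ∧ CCP.Sim C γ.store γ.proc δ.proc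

theorem Conf.Sim.symm {γ δ : Conf V Con ar} (h : Conf.Sim C γ δ) : Conf.Sim C δ γ :=
  ⟨h.1.symm, h.1 ▸ h.2.symm⟩

theorem Conf.Sim.trans {γ δ η : Conf V Con ar} (h : Conf.Sim C γ δ) (h' : Conf.Sim C δ η) :
    Conf.Sim C γ η :=
  ⟨h.1.trans h'.1, h.2.trans (h.1 ▸ h'.2)⟩

theorem Conf.Sim.add {γ δ : Conf V Con ar} (h : Conf.Sim C γ δ) (a : Con) :
    Conf.Sim C (γ.add a) (δ.add a) :=
  ⟨congrArg (· ⊔ a) h.1, h.2.mono le_sup_left⟩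

theorem Conf.add_add (γ : Conf V Con ar) (a b : Con) : (γ.add a).add b = γ.add (a ⊔ b) := by
  simp [Conf.add, sup_assoc]

theorem Conf.add_of_le {γ : Conf V Con ar} {a : Con} (h : a ≤ γ.store) : γ.add a = γ := by
  cases γ
  simpa [Conf.add] using h

/-- The join of finite constraints. -/
def FinCon.sup (a b : FinCon Con) : FinCon Con := ⟨a.1 ⊔ b.1, compact_sup a.2 b.2⟩

theorem Step.red (hD : D.Tame) {γ γ' δ : Conf V Con ar} {α : FinCon Con} {a : Con}
    (h : Step C D γ α γ') (ha : α.1 ≤ a) (hS : Conf.Sim C (γ.add a) δ) :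
    ∃ δ', Red C D δ δ' ∧ Conf.Sim C (γ'.add a) δ' := by
  obtain ⟨Q, d⟩ := δ
  obtain ⟨rfl : γ.store ⊔ a = d, hS⟩ := hS
  obtain ⟨Q', hr, hs⟩ := h.sound hD ha hS
  exact ⟨_, hr, rfl, hs⟩

theorem Red.step [Infinite V] [WellFoundedLT (FinCon Con)] (hD : D.Tame)
    {γ δ δ' : Conf V Con ar} {a : FinCon Con} (h : Red C D δ δ')
    (hS : Conf.Sim C δ (γ.add a.1)) :
    ∃ α γ', α ≤ a ∧ Step C D γ α γ' ∧ Conf.Sim C δ' (γ'.add a.1) := by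
  obtain ⟨α, γ', hα, hs, he, hS'⟩ := h.complete hD hS.1 hS.2
  exact ⟨α, γ', hα, hs, he, hS'⟩

/-- The reduction is turned into a transition of `δ` with a label below `⊥`, and this one back into
a reduction. -/
theorem Red.sim [Infinite V] [WellFoundedLT (FinCon Con)] (hD : D.Tame)
    {γ γ' δ : Conf V Con ar} (h : Red C D γ γ') (hS : Conf.Sim C γ δ) :
    ∃ δ', Red C D δ δ' ∧ Conf.Sim C γ' δ' := by
  have hbot : δ.add (⊥ : Con) = δ := Conf.add_of_le bot_le
  obtain ⟨α, δ₁, hα, hs, hS₁⟩ := h.step hD (γ := δ) (a := ⟨⊥, compact_bot⟩) (by rwa [hbot])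
  have hδ : Conf.Sim C (δ.add (⊥ : Con)) δ := hbot.symm ▸ hS.symm.trans hS
  obtain ⟨δ', hr, hS'⟩ := hs.red hD hα hδ
  exact ⟨δ', hr, hS₁.trans hS'⟩

/-- The configuration is similar to itself. -/
def Conf.Good (C : Cylindric V Con) (γ : Conf V Con ar) : Prop := Conf.Sim C γ γ

theorem Conf.Good.add {γ : Conf V Con ar} (h : γ.Good C) (a : Con) : (γ.add a).Good C :=
  Conf.Sim.add h a

theorem Conf.Good.step (hD : D.Tame) {γ γ' : Conf V Con ar} {α : FinCon Con} (hγ : γ.Good C)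
    (h : Step C D γ α γ') : γ'.Good C := by
  obtain ⟨δ, -, hS⟩ := h.red hD le_rfl (hγ.add α.1)
  rw [Conf.add_of_le (le_sup_right.trans h.store_sup_le)] at hS
  -- A configuration similar to anything is similar to itself.
  exact hS.trans hS.symm

/-- The store of `γ₁` already contains `α`, so adding `e` or `β = α ⊔ e` gives the same result: the
target does not depend on the choice of `e`. -/
theorem Derives.eq_add {γ γ₁ γ₂ : Conf V Con ar} {α β : FinCon Con}
    (h : Derives C D γ α γ₁ β γ₂) : α < β ∧ γ₂ = γ₁.add β.1 := by
  obtain ⟨hs, hp, e, he, hst, hne⟩ := h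
  have hle : α ≤ β := show α.1 ≤ β.1 from he ▸ le_sup_left
  refine ⟨lt_of_le_of_ne hle hne, ?_⟩
  have hα : α.1 ≤ γ₁.store := le_sup_right.trans hs.store_sup_le
  obtain ⟨P₂, d₂⟩ := γ₂
  dsimp only at hp hst
  rw [Conf.add, hp, hst, he, ← sup_assoc, sup_eq_left.2 hα]

theorem Step.derives {γ γ₁ : Conf V Con ar} {α β : FinCon Con} (h : Step C D γ α γ₁)
    (hlt : α < β) : Derives C D γ α γ₁ β (γ₁.add β.1) :=
  ⟨h, rfl, β.1, (sup_eq_right.2 (show α.1 ≤ β.1 from hlt.le)).symm, rfl, hlt.ne⟩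

variable {IS : Set (Conf V Con ar)}

theorem Closure.good (hD : D.Tame) (hIS : ∀ γ ∈ IS, γ.Good C) {γ : Conf V Con ar}
    (h : Closure C D IS γ) : γ.Good C := by
  induction h with
  | is γ hγ => exact hIS γ hγ
  | rs γ₁ γ₂ α _ hs ih => exact ih.step hD hs
  | rd γ γ₁ γ₂ γ₃ α₁ α₂ _ hs _ hd ih =>
    rw [hd.eq_add.2]
    exact (ih.step hD hs).add _

theorem Closure.add {γ γ₁ γ₂ : Conf V Con ar} {α β : FinCon Con} (h : Closure C D IS γ)
    (h₁ : Step C D γ α γ₁) (h₂ : Step C D γ β γ₂) (hlt : α < β) :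
    Closure C D IS (γ₁.add β.1) :=
  .rd γ γ₁ γ₂ _ α β h h₁ h₂ (h₁.derives hlt)

/-! ### Approximants of saturated barbed bisimilarity -/

/-- Every reduction of `γ₁` with an additional constraint is matched by one of `γ₂` with the same
constraint, up to `B`. -/
def SatMatches (C : Cylindric V Con) (D : ProcDefs C ar)
    (B : Conf V Con ar → Conf V Con ar → Prop) (γ₁ γ₂ : Conf V Con ar) : Prop :=
  ∀ (a : FinCon Con) (δ₁), Red C D (γ₁.add a.1) δ₁ → ∃ δ₂, Red C D (γ₂.add a.1) δ₂ ∧ B δ₁ δ₂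

/-- Equivalence relations that contain similarity and are closed under addition of constraints. -/
structure IsSatEquiv (C : Cylindric V Con) (B : Conf V Con ar → Conf V Con ar → Prop) :
    Prop where
  refl : ∀ γ, B γ γ
  symm : ∀ γ₁ γ₂, B γ₁ γ₂ → B γ₂ γ₁
  trans : ∀ γ₁ γ₂ γ₃, B γ₁ γ₂ → B γ₂ γ₃ → B γ₁ γ₃
  sim : ∀ γ₁ γ₂, Conf.Sim C γ₁ γ₂ → B γ₁ γ₂
  add : ∀ γ₁ γ₂, B γ₁ γ₂ → ∀ a : FinCon Con, B (γ₁.add a.1) (γ₂.add a.1)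

/-! ### Irredundant transitions versus saturated matching -/

theorem Dominates.lt {P : Conf V Con ar → Conf V Con ar → Prop} {γ γ₁ γ₂ : Conf V Con ar}
    {α β : FinCon Con} (h : Dominates C D P γ α γ₁ β γ₂) : α < β := by
  obtain ⟨_, _, _, hd, _⟩ := h
  exact hd.eq_add.1

/-- Every transition lies above an irredundant one. -/
theorem Step.exists_irredundant [WellFoundedLT (FinCon Con)]
    {P B : Conf V Con ar → Conf V Con ar → Prop} (hB : IsSatEquiv C B)
    (hPB : ∀ γ₁ γ₂, P γ₁ γ₂ → B γ₁ γ₂) {γ γ₁ : Conf V Con ar} {α : FinCon Con}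
    (h : Step C D γ α γ₁) :
    ∃ β γ₂, β ≤ α ∧ Irredundant C D P γ β γ₂ ∧
      ∀ a : FinCon Con, α ≤ a → B (γ₂.add a.1) (γ₁.add a.1) := by
  induction α using WellFoundedLT.induction generalizing γ₁ with
  | ind α ih =>
    by_cases hirr : Irredundant C D P γ α γ₁
    · exact ⟨α, γ₁, le_rfl, hirr, fun a _ => hB.refl _⟩
    · obtain ⟨β, γ₂, hdom⟩ : ∃ β γ₂, Dominates C D P γ β γ₂ α γ₁ := by
        by_contra hn
        exact hirr ⟨h, hn⟩
      have hlt := hdom.lt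
      obtain ⟨hs, -, γ₃, hd, hP⟩ := hdom
      obtain rfl := hd.eq_add.2
      obtain ⟨β', γ', hle, hirr', hB'⟩ := ih β hlt hs
      refine ⟨β', γ', hle.trans hlt.le, hirr', fun a ha => ?_⟩
      refine hB.trans _ _ _ (hB' a (hlt.le.trans ha)) ?_
      -- Domination relates `γ₂` with `α` added to `γ₁`; adding `a ≥ α` on both sides absorbs `α`.
      have := hB.add _ _ (hPB _ _ hP) a
      rwa [Conf.add_add, sup_eq_right.2 (show α.1 ≤ a.1 from ha)] at this

/-- The reduction comes from a transition with a label below `a`, hence from an irredundant one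
below that; the answer of `γ₂` to the latter is a reduction once `a` is added. -/
theorem Matches.satMatches [Infinite V] [WellFoundedLT (FinCon Con)] (hD : D.Tame)
    {P B : Conf V Con ar → Conf V Con ar → Prop} (hB : IsSatEquiv C B)
    (hPB : ∀ γ₁ γ₂, P γ₁ γ₂ → B γ₁ γ₂) {γ₁ γ₂ : Conf V Con ar} (h₁ : γ₁.Good C) (h₂ : γ₂.Good C)
    (h : Matches C D P γ₁ γ₂) : SatMatches C D B γ₁ γ₂ := by
  intro a δ₁ hr
  obtain ⟨α, γ₁', hα, hs, hS⟩ := hr.step hD (h₁.add a.1)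
  obtain ⟨β, γ₁'', hβ, hirr, hBγ⟩ := hs.exists_irredundant hB hPB
  obtain ⟨γ₂', hs₂, hP⟩ := h _ _ hirr
  obtain ⟨δ₂, hr₂, hS₂⟩ := hs₂.red hD (hβ.trans hα) (h₂.add a.1)
  refine ⟨δ₂, hr₂, hB.trans _ _ _ (hB.sim _ _ hS) <| hB.trans _ _ _ (hB.symm _ _ (hBγ a hα)) <|
    hB.trans _ _ _ (hB.add _ _ (hPB _ _ hP) a) (hB.sim _ _ hS₂)⟩

theorem SatMatches.matches [Infinite V] [WellFoundedLT (FinCon Con)] (hD : D.Tame)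
    {P B : Conf V Con ar → Conf V Con ar → Prop} (hB : IsSatEquiv C B)
    (hBP : ∀ γ₁ γ₂, Closure C D IS γ₁ → Closure C D IS γ₂ → B γ₁ γ₂ → P γ₁ γ₂)
    {γ₁ γ₂ : Conf V Con ar} (h₁ : γ₁.Good C) (h₂ : γ₂.Good C) (hc₁ : Closure C D IS γ₁)
    (hc₂ : Closure C D IS γ₂) (h : SatMatches C D B γ₁ γ₂) (h' : SatMatches C D B γ₂ γ₁) :
    Matches C D P γ₁ γ₂ := by
  intro α γ₁' hirr
  obtain ⟨δ₁, hr₁, hS₁⟩ := hirr.1.red hD le_rfl (h₁.add α.1)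
  rw [Conf.add_of_le (le_sup_right.trans hirr.1.store_sup_le)] at hS₁
  obtain ⟨δ₂, hr₂, hBδ⟩ := h α δ₁ hr₁
  obtain ⟨β, γ₂', hβ, hs₂, hS₂⟩ := hr₂.step hD (h₂.add α.1)
  have hB₁ : B γ₁' (γ₂'.add α.1) :=
    hB.trans _ _ _ (hB.sim _ _ hS₁) (hB.trans _ _ _ hBδ (hB.sim _ _ hS₂))
  rcases eq_or_lt_of_le hβ with rfl | hlt
  · rw [Conf.add_of_le (le_sup_right.trans hs₂.store_sup_le)] at hB₁
    exact ⟨γ₂', hs₂, hBP _ _ (.rs _ _ _ hc₁ hirr.1) (.rs _ _ _ hc₂ hs₂) hB₁⟩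
  -- A strictly smaller answer `β` is played back to `γ₁`, which answers with some `β' ≤ β < α`.
  -- That transition dominates the given one, against its irredundance.
  · exfalso
    obtain ⟨η₂, hq₂, hT₂⟩ := hs₂.red hD le_rfl (h₂.add β.1)
    rw [Conf.add_of_le (le_sup_right.trans hs₂.store_sup_le)] at hT₂
    obtain ⟨η₁, hq₁, hBη⟩ := h' β η₂ hq₂
    obtain ⟨β', γ₁'', hβ', hs₁, hT₁⟩ := hq₁.step hD (h₁.add β.1)
    have hlt' : β' < α := lt_of_le_of_lt hβ' hlt
    have hB₂ : B γ₂' (γ₁''.add β.1) :=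
      hB.trans _ _ _ (hB.sim _ _ hT₂) (hB.trans _ _ _ hBη (hB.sim _ _ hT₁))
    have hB₃ := hB.add _ _ hB₂ α
    rw [Conf.add_add, sup_eq_right.2 (show β.1 ≤ α.1 from hβ)] at hB₃
    refine hirr.2 ⟨β', γ₁'', hs₁, hirr.1, γ₁''.add α.1, hs₁.derives hlt', ?_⟩
    -- Passing from `B` to `P` needs both configurations in `IS⋆`; for the derived one this is rule
    -- (rd).
    exact hBP _ _ (hc₁.add hs₁ hirr.1 hlt') (.rs _ _ _ hc₁ hirr.1)
      (hB.symm _ _ (hB.trans _ _ _ hB₁ hB₃))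

/-- The approximants of saturated barbed bisimilarity. -/
def approx (C : Cylindric V Con) (D : ProcDefs C ar) : ℕ → Conf V Con ar → Conf V Con ar → Prop
  | 0 => fun γ₁ γ₂ => γ₁.store = γ₂.store
  | n + 1 => fun γ₁ γ₂ => approx C D n γ₁ γ₂ ∧
      SatMatches C D (approx C D n) γ₁ γ₂ ∧ SatMatches C D (approx C D n) γ₂ γ₁

theorem approx_store {n : ℕ} {γ₁ γ₂ : Conf V Con ar} (h : approx C D n γ₁ γ₂) :
    γ₁.store = γ₂.store := by
  induction n with
  | zero => exact h
  | succ n ih => exact ih h.1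

theorem SatMatches.trans {B : Conf V Con ar → Conf V Con ar → Prop} (hB : IsSatEquiv C B)
    {γ₁ γ₂ γ₃ : Conf V Con ar} (h : SatMatches C D B γ₁ γ₂) (h' : SatMatches C D B γ₂ γ₃) :
    SatMatches C D B γ₁ γ₃ := by
  intro a δ₁ hr
  obtain ⟨δ₂, hr₂, h₂⟩ := h a δ₁ hr
  obtain ⟨δ₃, hr₃, h₃⟩ := h' a δ₂ hr₂
  exact ⟨δ₃, hr₃, hB.trans _ _ _ h₂ h₃⟩

theorem SatMatches.add {B : Conf V Con ar → Conf V Con ar → Prop} {γ₁ γ₂ : Conf V Con ar}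
    (h : SatMatches C D B γ₁ γ₂) (a : FinCon Con) :
    SatMatches C D B (γ₁.add a.1) (γ₂.add a.1) := by
  intro b δ₁ hr
  simp only [Conf.add_add] at hr ⊢
  exact h (a.sup b) δ₁ hr

theorem satMatches_of_sim [Infinite V] [WellFoundedLT (FinCon Con)] (hD : D.Tame)
    {B : Conf V Con ar → Conf V Con ar → Prop} (hB : IsSatEquiv C B) {γ₁ γ₂ : Conf V Con ar}
    (h : Conf.Sim C γ₁ γ₂) : SatMatches C D B γ₁ γ₂ := by
  intro a δ₁ hr
  obtain ⟨δ₂, hr₂, hS⟩ := hr.sim hD (h.add a.1)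
  exact ⟨δ₂, hr₂, hB.sim _ _ hS⟩

theorem approx_isSatEquiv [Infinite V] [WellFoundedLT (FinCon Con)] (hD : D.Tame) (n : ℕ) :
    IsSatEquiv C (approx C D n) := by
  induction n with
  | zero =>
    exact ⟨fun _ => rfl, fun _ _ h => h.symm, fun _ _ _ h h' => h.trans h', fun _ _ h => h.1,
      fun _ _ h a => congrArg (· ⊔ a.1) h⟩
  | succ n ih =>
    have hrefl (γ : Conf V Con ar) : SatMatches C D (approx C D n) γ γ :=
      fun _ δ hr => ⟨δ, hr, ih.refl δ⟩
    exact ⟨fun γ => ⟨ih.refl γ, hrefl γ, hrefl γ⟩,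
      fun _ _ h => ⟨ih.symm _ _ h.1, h.2.2, h.2.1⟩,
      fun _ _ _ h h' => ⟨ih.trans _ _ _ h.1 h'.1, h.2.1.trans ih h'.2.1, h'.2.2.trans ih h.2.2⟩,
      fun _ _ h => ⟨ih.sim _ _ h, satMatches_of_sim hD ih h, satMatches_of_sim hD ih h.symm⟩,
      fun _ _ h a => ⟨ih.add _ _ h.1 a, h.2.1.add a, h.2.2.add a⟩⟩

/-- On `IS⋆` the computed partitions are the approximants of saturated barbed bisimilarity. -/
theorem part_iff_approx [Infinite V] [WellFoundedLT (FinCon Con)] (hD : D.Tame)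
    (hIS : ∀ γ ∈ IS, γ.Good C) (n : ℕ) (γ₁ γ₂ : Conf V Con ar) :
    part C D IS n γ₁ γ₂ ↔ γ₁ ∈ ISstar C D IS ∧ γ₂ ∈ ISstar C D IS ∧ approx C D n γ₁ γ₂ := by
  induction n generalizing γ₁ γ₂ with
  | zero => exact Iff.rfl
  | succ n ih =>
    have hB := approx_isSatEquiv hD n
    have hPB (γ₁ γ₂) (h : part C D IS n γ₁ γ₂) : approx C D n γ₁ γ₂ := ((ih γ₁ γ₂).1 h).2.2
    have hBP (γ₁ γ₂) (h₁ : Closure C D IS γ₁) (h₂ : Closure C D IS γ₂)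
      (h : approx C D n γ₁ γ₂) : part C D IS n γ₁ γ₂ := (ih γ₁ γ₂).2 ⟨h₁, h₂, h⟩
    constructor
    · rintro ⟨hP, hM, hM'⟩
      obtain ⟨hc₁, hc₂, hA⟩ := (ih γ₁ γ₂).1 hP
      have h₁ := Closure.good hD hIS hc₁
      have h₂ := Closure.good hD hIS hc₂
      exact ⟨hc₁, hc₂, hA, hM.satMatches hD hB hPB h₁ h₂, hM'.satMatches hD hB hPB h₂ h₁⟩
    · rintro ⟨hc₁, hc₂, hA, hM, hM'⟩
      have h₁ := Closure.good hD hIS hc₁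
      have h₂ := Closure.good hD hIS hc₂
      exact ⟨hBP _ _ hc₁ hc₂ hA, hM.matches hD hB hBP h₁ h₂ hc₁ hc₂ hM',
        hM'.matches hD hB hBP h₂ h₁ hc₂ hc₁ hM⟩

/-- Transitivity is not evident from `IR`, as an irredundant transition may be answered by a
redundant one. It is inherited from the approximants. -/
theorem part_isPartitionRel [Infinite V] [WellFoundedLT (FinCon Con)] (hD : D.Tame)
    (hIS : ∀ γ ∈ IS, γ.Good C) (n : ℕ) : IsPartitionRel (ISstar C D IS) (part C D IS n) := by
  have hB := approx_isSatEquiv hD n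
  have hiff := part_iff_approx hD hIS n
  refine ⟨fun a b h => ?_, fun a h => ?_, fun a b h => ?_, fun a b c h h' => ?_⟩
  · exact ⟨((hiff a b).1 h).1, ((hiff a b).1 h).2.1⟩
  · exact (hiff a a).2 ⟨h, h, hB.refl a⟩
  · obtain ⟨h₁, h₂, h₃⟩ := (hiff a b).1 h
    exact (hiff b a).2 ⟨h₂, h₁, hB.symm _ _ h₃⟩
  · obtain ⟨h₁, _, h₃⟩ := (hiff a b).1 h
    obtain ⟨_, h₄, h₅⟩ := (hiff b c).1 h'
    exact (hiff a c).2 ⟨h₁, h₄, hB.trans _ _ _ h₃ h₅⟩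

/-! ### Saturated barbed bisimilarity and stable partitions -/

/-- Equal barbs give equal stores because the lattice is compactly generated; upward closure turns
matching of reductions into saturated matching. -/
theorem satBarbedBisimilar_approx [IsCompactlyGenerated Con] {γ₁ γ₂ : Conf V Con ar}
    (h : SatBarbedBisimilar C D γ₁ γ₂) (n : ℕ) : approx C D n γ₁ γ₂ := by
  obtain ⟨R, hR, h⟩ := h
  induction n generalizing γ₁ γ₂ with
  | zero =>
    have hle (γ₁ γ₂) (h : R γ₁ γ₂) : γ₁.store ≤ γ₂.store :=
      le_iff_compact_le_imp.2 fun c hc hle => hR.barb _ _ h ⟨c, hc⟩ hle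
    exact le_antisymm (hle _ _ h) (hle _ _ (hR.symm _ _ h))
  | succ n ih =>
    have hM (γ₁ γ₂) (h : R γ₁ γ₂) : SatMatches C D (approx C D n) γ₁ γ₂ := by
      intro a δ₁ hr
      obtain ⟨δ₂, hr₂, h₂⟩ := hR.red _ _ (hR.upward _ _ h a) _ hr
      exact ⟨δ₂, hr₂, ih h₂⟩
    exact ⟨ih h, hM _ _ h, hM _ _ (hR.symm _ _ h)⟩

/-- Closure of a relation under addition of constraints and similarity. -/
def SatLink (C : Cylindric V Con) (P : Conf V Con ar → Conf V Con ar → Prop)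
    (γ₁ γ₂ : Conf V Con ar) : Prop :=
  Conf.Sim C γ₁ γ₂ ∨ P γ₁ γ₂ ∨
    ∃ (δ₁ δ₂ : Conf V Con ar) (a : FinCon Con), P δ₁ δ₂ ∧ γ₁ = δ₁.add a.1 ∧ γ₂ = δ₂.add a.1

theorem SatLink.add {P : Conf V Con ar → Conf V Con ar → Prop} {γ₁ γ₂ : Conf V Con ar}
    (h : SatLink C P γ₁ γ₂) (a : FinCon Con) : SatLink C P (γ₁.add a.1) (γ₂.add a.1) := by
  rcases h with h | h | ⟨δ₁, δ₂, b, h, rfl, rfl⟩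
  · exact .inl (h.add a.1)
  · exact .inr (.inr ⟨γ₁, γ₂, a, h, rfl, rfl⟩)
  · exact .inr (.inr ⟨δ₁, δ₂, b.sup a, h, Conf.add_add _ _ _, Conf.add_add _ _ _⟩)

theorem SatLink.symm {P : Conf V Con ar → Conf V Con ar → Prop} (hP : ∀ γ₁ γ₂, P γ₁ γ₂ → P γ₂ γ₁)
    {γ₁ γ₂ : Conf V Con ar} (h : SatLink C P γ₁ γ₂) : SatLink C P γ₂ γ₁ := by
  rcases h with h | h | ⟨δ₁, δ₂, b, h, h₁, h₂⟩
  · exact .inl h.symm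
  · exact .inr (.inl (hP _ _ h))
  · exact .inr (.inr ⟨δ₂, δ₁, b, hP _ _ h, h₂, h₁⟩)

theorem satLink_isSatEquiv {P : Conf V Con ar → Conf V Con ar → Prop}
    (hP : ∀ γ₁ γ₂, P γ₁ γ₂ → P γ₂ γ₁) :
    IsSatEquiv C (Relation.ReflTransGen (SatLink C P)) where
  refl _ := .refl
  symm _ _ h := by
    have : Std.Symm (SatLink C P) := ⟨fun _ _ h => h.symm hP⟩
    exact Std.Symm.symm _ _ h
  trans _ _ _ h h' := h.trans h'
  sim _ _ h := .single (.inl h)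
  add _ _ h a := h.lift (fun γ => γ.add a.1) fun _ _ h => h.add a

/-- A stable relation between configurations with equal stores is contained in saturated barbed
bisimilarity. -/
theorem satBarbedBisimilar_of_stable [Infinite V] [WellFoundedLT (FinCon Con)] (hD : D.Tame)
    {P : Conf V Con ar → Conf V Con ar → Prop} (hsymm : ∀ γ₁ γ₂, P γ₁ γ₂ → P γ₂ γ₁)
    (hstore : ∀ γ₁ γ₂, P γ₁ γ₂ → γ₁.store = γ₂.store) (hgood : ∀ γ₁ γ₂, P γ₁ γ₂ → γ₁.Good C)
    (hM : ∀ γ₁ γ₂, P γ₁ γ₂ → Matches C D P γ₁ γ₂) {γ₁ γ₂ : Conf V Con ar} (h : P γ₁ γ₂) :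
    SatBarbedBisimilar C D γ₁ γ₂ := by
  have hB := satLink_isSatEquiv (C := C) hsymm
  have hPM (γ₁ γ₂) (h : P γ₁ γ₂) :
      SatMatches C D (Relation.ReflTransGen (SatLink C P)) γ₁ γ₂ :=
    (hM _ _ h).satMatches hD hB (fun _ _ h => .single (.inr (.inl h))) (hgood _ _ h)
      (hgood _ _ (hsymm _ _ h))
  have hbot (γ : Conf V Con ar) : γ.add (⊥ : Con) = γ := Conf.add_of_le bot_le
  -- The bisimulation consists of chains of links, since `P` is not assumed closed under added
  -- constraints and answers are known only up to similarity.
  refine ⟨_, ⟨hB.symm, fun γ₁ γ₂ h => ?_, fun γ₁ γ₂ h => ?_, hB.add⟩, .single (.inr (.inl h))⟩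
  · have : γ₁.store = γ₂.store := by
      induction h with
      | refl => rfl
      | tail _ hl ih =>
        refine ih.trans ?_
        rcases hl with h | h | ⟨δ₁, δ₂, b, h, rfl, rfl⟩
        · exact h.1
        · exact hstore _ _ h
        · exact congrArg (· ⊔ b.1) (hstore _ _ h)
    intro c hc
    exact hc.trans this.le
  · induction h with
    | refl => exact fun δ hr => ⟨δ, hr, .refl⟩
    | tail _ hl ih =>
      intro δ₁ hr
      obtain ⟨δ₂, hr₂, h₂⟩ := ih δ₁ hr
      suffices h : ∃ δ₃, Red C D _ δ₃ ∧ Relation.ReflTransGen (SatLink C P) δ₂ δ₃ by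
        obtain ⟨δ₃, hr₃, h₃⟩ := h
        exact ⟨δ₃, hr₃, h₂.trans h₃⟩
      rcases hl with h | h | ⟨η₁, η₂, b, h, rfl, rfl⟩
      · have := satMatches_of_sim hD hB h ⟨⊥, compact_bot⟩ δ₂
        simp only [hbot] at this
        exact this hr₂
      · have := hPM _ _ h ⟨⊥, compact_bot⟩ δ₂
        simp only [hbot] at this
        exact this hr₂
      · exact hPM _ _ h b δ₂ hr₂

/-! ### Termination -/

/-- Otherwise `f` would grow strictly through `N + 1` consecutive steps and exceed `N`. -/
theorem exists_le_eq_succ {X : Type*} {N : ℕ} (s : ℕ → X) (f : X → ℕ) (hf : ∀ n, f (s n) ≤ N)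
    (hlt : ∀ n, s n ≠ s (n + 1) → f (s n) < f (s (n + 1))) : ∃ n ≤ N, s n = s (n + 1) := by
  by_contra! hne
  have hge : ∀ n ≤ N + 1, n ≤ f (s n) := by
    intro n hn
    induction n with
    | zero => exact Nat.zero_le _
    | succ n ih => exact (ih (by omega)).trans_lt (hlt n (hne n (by omega)))
  exact absurd (hge (N + 1) le_rfl) (by have := hf (N + 1); omega)

theorem closureStage_subset_succ (n : ℕ) :
    closureStage C D IS n ⊆ closureStage C D IS (n + 1) :=
  fun _ h => .inl (.inl h)

theorem closureStage_subset_ISstar (n : ℕ) : closureStage C D IS n ⊆ ISstar C D IS := by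
  induction n with
  | zero => exact fun γ h => .is γ h
  | succ n ih =>
    rintro γ ((h | ⟨γ₁, h, α, hs⟩) | ⟨γ₁, h, α₁, δ₁, α₂, δ₂, hs₁, hs₂, hd⟩)
    · exact ih h
    · exact .rs _ _ _ (ih h) hs
    · exact .rd _ _ _ _ _ _ (ih h) hs₁ hs₂ hd

theorem closureStage_eq_ISstar {n : ℕ}
    (h : closureStage C D IS n = closureStage C D IS (n + 1)) :
    closureStage C D IS n = ISstar C D IS := by
  refine (closureStage_subset_ISstar n).antisymm fun γ hγ => ?_
  induction hγ with
  | is γ hγ =>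
    exact monotone_nat_of_le_succ (f := closureStage C D IS) closureStage_subset_succ n.zero_le hγ
  | rs γ₁ γ₂ α _ hs ih => exact h ▸ .inl (.inr ⟨γ₁, ih, α, hs⟩)
  | rd γ γ₁ γ₂ γ₃ α₁ α₂ _ hs₁ hs₂ hd ih =>
    exact h ▸ .inr ⟨γ, ih, α₁, γ₁, α₂, γ₂, hs₁, hs₂, hd⟩

theorem exists_closureStage_eq_succ (hfin : (ISstar C D IS).Finite) :
    ∃ k ≤ (ISstar C D IS).ncard, closureStage C D IS k = closureStage C D IS (k + 1) := by
  refine exists_le_eq_succ _ Set.ncard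
    (fun n => Set.ncard_le_ncard (closureStage_subset_ISstar n) hfin) fun n hn => ?_
  exact Set.ncard_lt_ncard ((closureStage_subset_succ n).ssubset_of_ne hn)
    (hfin.subset (closureStage_subset_ISstar _))

/-- The number of blocks of a partition. -/
noncomputable def blockCount {X : Type*} (S : Set X) (R : X → X → Prop) : ℕ :=
  ((fun a => {b | R a b}) '' S).ncard

/-- Sending a block of `R'` to the block of `R` around it is surjective; with equally many blocks it
is also injective, and then the relations agree. -/
theorem blockCount_lt {X : Type*} {S : Set X} (hS : S.Finite) {R R' : X → X → Prop}
    (hR : IsPartitionRel S R) (hR' : IsPartitionRel S R') (hle : ∀ a b, R' a b → R a b)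
    (hne : R ≠ R') : blockCount S R < blockCount S R' := by
  let g : Set X → Set X := fun A => {b | ∃ a ∈ A, R a b}
  have hg (a) (ha : a ∈ S) : g {b | R' a b} = {b | R a b} := by
    ext b
    exact ⟨fun ⟨c, hc, hb⟩ => hR.trans _ _ _ (hle _ _ hc) hb, fun hb => ⟨a, hR'.refl a ha, hb⟩⟩
  have himg : (fun a => {b | R a b}) '' S = g '' ((fun a => {b | R' a b}) '' S) := by
    rw [Set.image_image]
    exact Set.image_congr fun a ha => (hg a ha).symm
  have hfin := hS.image fun a => {b | R' a b}
  refine lt_of_le_of_ne ?_ fun heq => hne ?_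
  · rw [blockCount, himg]
    exact Set.ncard_image_le hfin
  · rw [blockCount, himg] at heq
    have hinj := (Set.ncard_image_iff hfin).1 heq
    funext a b
    refine propext ⟨fun h => ?_, hle a b⟩
    obtain ⟨ha, hb⟩ := hR.mem a b h
    have hab : {c | R a c} = {c | R b c} := by
      ext c
      exact ⟨hR.trans _ _ _ (hR.symm _ _ h), hR.trans _ _ _ h⟩
    have h' : {c | R' a c} = {c | R' b c} :=
      hinj ⟨a, ha, rfl⟩ ⟨b, hb, rfl⟩ (by rw [hg a ha, hg b hb, hab])
    exact h'.symm.subset (hR'.refl b hb)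

theorem exists_stopsAt (hfin : (ISstar C D IS).Finite)
    (hpart : ∀ n, IsPartitionRel (ISstar C D IS) (part C D IS n)) :
    ∃ n ≤ (ISstar C D IS).ncard, StopsAt C D IS n := by
  classical
  obtain ⟨n, hn, heq⟩ := exists_le_eq_succ (part C D IS) (blockCount (ISstar C D IS))
    (fun n => Set.ncard_image_le hfin)
    fun n hne => blockCount_lt hfin (hpart n) (hpart (n + 1)) (fun _ _ h => h.1) hne
  have hex : ∃ n, part C D IS n = part C D IS (n + 1) := ⟨n, heq⟩
  exact ⟨Nat.find hex, (Nat.find_min' hex heq).trans hn, Nat.find_spec hex,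
    fun m hm => Nat.find_min hex hm⟩

end

end CCP

theorem mainTheorem2 {V Con I : Type*} [Infinite V] [CompleteLattice Con]
    [IsCompactlyGenerated Con] (C : CCP.Cylindric V Con) {ar : I → ℕ}
    (D : CCP.ProcDefs C ar) (IS : Set (CCP.Conf V Con ar))
    (hwf : WellFoundedLT Con ∨
      (WellFoundedLT (CCP.FinCon Con) ∧ (∀ p, (D.body p).HidingFree) ∧
        ∀ γ ∈ IS, γ.proc.HidingFree))
    (hfin : (CCP.ISstar C D IS).Finite) :
    (∃ k ≤ (CCP.ISstar C D IS).ncard,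
      CCP.closureStage C D IS k = CCP.closureStage C D IS (k + 1) ∧
      CCP.closureStage C D IS k = CCP.ISstar C D IS) ∧
    (∀ n, CCP.IsPartitionRel (CCP.ISstar C D IS) (CCP.part C D IS n)) ∧
    ∃ n ≤ (CCP.ISstar C D IS).ncard, CCP.StopsAt C D IS n ∧
      ∀ γ₁ ∈ CCP.ISstar C D IS, ∀ γ₂ ∈ CCP.ISstar C D IS,
        (CCP.part C D IS n γ₁ γ₂ ↔ CCP.SatBarbedBisimilar C D γ₁ γ₂) := by
  -- Both alternatives of the hypothesis enter the proof only through these three consequences.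
  obtain ⟨hwf₀, hD, hIS⟩ : WellFoundedLT (CCP.FinCon Con) ∧ D.Tame ∧ ∀ γ ∈ IS, γ.Good C := by
    rcases hwf with hwf | ⟨hwf, hD, hIS⟩
    · have hC := C.isTrivial_of_wellFoundedLT
      exact ⟨inferInstance, .inl hC, fun γ _ => ⟨rfl, .refl (.inl hC) _⟩⟩
    · exact ⟨hwf, .inr hD, fun γ hγ => ⟨rfl, .refl (.inr (hIS γ hγ)) _⟩⟩
  have hpart := CCP.part_isPartitionRel (D := D) hD hIS
  refine ⟨?_, hpart, ?_⟩
  · obtain ⟨k, hk, heq⟩ := CCP.exists_closureStage_eq_succ hfin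
    exact ⟨k, hk, heq, CCP.closureStage_eq_ISstar heq⟩
  · obtain ⟨n, hn, hfirst⟩ := CCP.exists_stopsAt hfin hpart
    refine ⟨n, hn, hfirst, fun γ₁ h₁ γ₂ h₂ => ⟨fun h => ?_, fun h => ?_⟩⟩
    · have hiff := CCP.part_iff_approx hD hIS n
      refine CCP.satBarbedBisimilar_of_stable hD (hpart n).symm
        (fun a b h => CCP.approx_store ((hiff a b).1 h).2.2)
        (fun a b h => CCP.Closure.good hD hIS ((hiff a b).1 h).1) (fun a b h => ?_) h
      -- Stability turns membership in the `n`-th partition into membership in its refinement, which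
      -- contains the matching condition.
      rw [hfirst.1] at h
      exact h.2.1
    · exact (CCP.part_iff_approx hD hIS n γ₁ γ₂).2
        ⟨h₁, h₂, CCP.satBarbedBisimilar_approx h n⟩
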